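/- Let $d\in\mathbb{N}$ and let $\mathcal{P}_2(\mathbb{R}^d)$ be the set of Borel probability measures on $\mathbb{R}^d$ with finite second moment, with the $L^2$-Wasserstein distance $$W_2^2(\mu,\nu)=\inf_{\gamma\in\Pi(\mu,\nu)}\int |x-y|^2\,\mathrm{d}\gamma(x,y),$$ where $\Pi(\mu,\nu)$ is the set of probability measures on $\mathbb{R}^d\times\mathbb{R}^d$ with marginals $\mu$ and $\nu$. Let $\alpha>1$ and $\beta=\alpha-1$, and for $\mu_0,\mu_1,\rho\in\mathcal{P}_2(\mathbb{R}^d)$ set $$\mathcal{F}(\mu_0,\mu_1;\rho)=\alpha W_2^2(\rho,\mu_1)-\beta W_2^2(\rho,\mu_0).$$ Then for all $\mu_0,\mu_1\in\mathcal{P}_2(\mathbb{R}^d)$ the metric extrapolation problem $$\min_{\rho\in\mathcal{P}_2(\mathbb{R}^d)}\mathcal{F}(\mu_0,\mu_1;\rho)$$ admits a unique solution $\mu_\alpha$. Moreover, the metric extrapolation $(\mu_0,\mu_1)\mapsto\mu_\alpha$ is $\beta$-dissipative, i.e. for all $\mu_0,\mu_1\in\mathcal{P}_2(\mathbb{R}^d)$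 $$W_2(\mu_1,\mu_\alpha)\le\beta\,W_2(\mu_0,\mu_1),$$ and for all $\mu_0,\mu_1,\mu\in\mathcal{P}_2(\mathbb{R}^d)$ $$W_2^2(\mu,\mu_\alpha)+\mathcal{F}(\mu_0,\mu_1;\mu_\alpha)\le\mathcal{F}(\mu_0,\mu_1;\mu).$$ -/

import Mathlib

open MeasureTheory Set
open scoped ENNReal

namespace WassersteinExtrapolation

/-- The set `P₂(ℝᵈ)` of Borel probability measures on Euclidean space `ℝᵈ` with finite second
moment. -/
abbrev P2 (d : ℕ) : Type :=
  {μ : ProbabilityMeasure (EuclideanSpace ℝ (Fin d)) //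
    ∫⁻ x, ‖x‖ₑ ^ 2 ∂(μ : Measure (EuclideanSpace ℝ (Fin d))) < ∞}

/-- The underlying measure of an element of `P₂(ℝᵈ)`. -/
def P2.toMeasure {d : ℕ} (μ : P2 d) : Measure (EuclideanSpace ℝ (Fin d)) :=
  (μ.1 : Measure (EuclideanSpace ℝ (Fin d)))

instance {d : ℕ} (μ : P2 d) : IsProbabilityMeasure μ.toMeasure :=
  inferInstanceAs (IsProbabilityMeasure (μ.1 : Measure (EuclideanSpace ℝ (Fin d))))

/-- The set `Π(μ, ν)` of transport plans: measures on `ℝᵈ × ℝᵈ` with marginals `μ` and `ν`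
(these are automatically probability measures, as `μ` and `ν` are). -/
def couplings {d : ℕ} (μ ν : P2 d) :
    Set (Measure (EuclideanSpace ℝ (Fin d) × EuclideanSpace ℝ (Fin d))) :=
  {γ | γ.map Prod.fst = μ.toMeasure ∧ γ.map Prod.snd = ν.toMeasure}

/-- The optimal transport cost `inf_{γ ∈ Π(μ, ν)} ∫ |x - y|² dγ(x, y)`, in `[0, ∞]`. -/
noncomputable def transportCost {d : ℕ} (μ ν : P2 d) : ℝ≥0∞ :=
  ⨅ γ ∈ couplings μ ν, ∫⁻ p, ‖p.1 - p.2‖ₑ ^ 2 ∂γ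

/-- The optimal transport cost between elements of `P₂(ℝᵈ)` is finite, so that nothing is lost
by regarding it as a real number. -/
theorem transportCost_lt_top {d : ℕ} (μ ν : P2 d) : transportCost μ ν < ∞ := by
  have hmem : μ.toMeasure.prod ν.toMeasure ∈ couplings μ ν := by
    constructor <;> simp [Measure.map_fst_prod, Measure.map_snd_prod]
  refine (iInf₂_le _ hmem).trans_lt ?_
  have hle : ∀ p : EuclideanSpace ℝ (Fin d) × EuclideanSpace ℝ (Fin d),
      ‖p.1 - p.2‖ₑ ^ 2 ≤ 2 * ‖p.1‖ₑ ^ 2 + 2 * ‖p.2‖ₑ ^ 2 := by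
    intro p
    have h1 : ‖p.1 - p.2‖₊ ^ 2 ≤ 2 * ‖p.1‖₊ ^ 2 + 2 * ‖p.2‖₊ ^ 2 := by
      rw [← NNReal.coe_le_coe]
      push_cast
      nlinarith [norm_sub_le p.1 p.2, norm_nonneg (p.1 - p.2), sq_nonneg (‖p.1‖ - ‖p.2‖)]
    simp only [enorm_eq_nnnorm]
    exact_mod_cast h1
  refine (lintegral_mono hle).trans_lt ?_
  have hm : Measurable fun x : EuclideanSpace ℝ (Fin d) => 2 * ‖x‖ₑ ^ 2 := by fun_prop
  have hμ : ∫⁻ x, ‖x‖ₑ ^ 2 ∂μ.toMeasure < ∞ := μ.2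
  have hν : ∫⁻ x, ‖x‖ₑ ^ 2 ∂ν.toMeasure < ∞ := ν.2
  rw [lintegral_add_left (by fun_prop),
    ← lintegral_map (μ := μ.toMeasure.prod ν.toMeasure) hm measurable_fst,
    ← lintegral_map (μ := μ.toMeasure.prod ν.toMeasure) hm measurable_snd, hmem.1, hmem.2,
    lintegral_const_mul _ (by fun_prop), lintegral_const_mul _ (by fun_prop)]
  exact ENNReal.add_lt_top.2
    ⟨ENNReal.mul_lt_top (by simp) hμ, ENNReal.mul_lt_top (by simp) hν⟩

/-- The `L²`-Wasserstein distance on `P₂(ℝᵈ)`. -/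
noncomputable def W2 {d : ℕ} (μ ν : P2 d) : ℝ :=
  Real.sqrt (transportCost μ ν).toReal

/-- The functional `ρ ↦ α W₂²(ρ, μ₁) - β W₂²(ρ, μ₀)` with `β = α - 1`. -/
noncomputable def extrapolationFunctional {d : ℕ} (α : ℝ) (μ₀ μ₁ ρ : P2 d) : ℝ :=
  α * W2 ρ μ₁ ^ 2 - (α - 1) * W2 ρ μ₀ ^ 2

/-- `ρ` solves the metric extrapolation problem for `(μ₀, μ₁)` at time `α`, that is, it minimizes
the extrapolation functional over all of `P₂(ℝᵈ)`. -/
def IsMetricExtrapolation {d : ℕ} (α : ℝ) (μ₀ μ₁ ρ : P2 d) : Prop :=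
  IsMinOn (extrapolationFunctional α μ₀ μ₁) univ ρ

/-- An extrapolation operator `E : P₂(ℝᵈ) × P₂(ℝᵈ) → P₂(ℝᵈ)` is `θ`-dissipative (`θ ≥ 0`) if
`W₂(μ₁, E(μ₀, μ₁)) ≤ θ W₂(μ₀, μ₁)` for all `μ₀, μ₁`. -/
def IsDissipative {d : ℕ} (θ : ℝ) (E : P2 d → P2 d → P2 d) : Prop :=
  0 ≤ θ ∧ ∀ μ₀ μ₁ : P2 d, W2 μ₁ (E μ₀ μ₁) ≤ θ * W2 μ₀ μ₁

end WassersteinExtrapolation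

/-! The functional is strongly convex along suitable curves, although neither of its terms alone
gives this. Take `X`, `Y` with laws `ρ₀`, `ρ₁`, both optimally coupled to one variable `O` of law
`μ₁`, and let `ρ` be the law of `(1 - t)X + tY`. By the quadratic identity `norm_interp_sub_sq`,
`W₂²(ρ, μ₁)` lies below its linear interpolation by at least `t(1 - t)E|X - Y|²`, while `W₂²(ρ, μ₀)`
lies below its own by at most that same defect, whatever the coupling of `X` and `Y`. The weights
`α` and `-(α - 1)` leave one defect, which is at least `t(1 - t)W₂²(ρ₀, ρ₁)`: this is
`exists_extrapolationFunctional_le`.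

Minimizing sequences are therefore Cauchy, and completeness of `P₂` gives a minimizer. Comparing it
with a competitor as `t → 0` gives the variational inequality, from which uniqueness and
dissipativity follow. -/

open scoped NNReal

namespace WassersteinExtrapolation

open Filter Topology ProbabilityTheory

/-! ### Weak compactness from second-moment bounds -/

section Compactness

variable {X : Type*} [NormedAddCommGroup X] [ProperSpace X]
  [MeasurableSpace X] [BorelSpace X]

/-- A family of measures with uniformly bounded second moments is tight. -/
theorem isTightMeasureSet_of_lintegral_sq_le {S : Set (Measure X)} {C : ℝ≥0∞} (hC : C ≠ ∞)
    (h : ∀ μ ∈ S, ∫⁻ x, ‖x‖ₑ ^ 2 ∂μ ≤ C) : IsTightMeasureSet S := by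
  rw [isTightMeasureSet_iff_tendsto_measure_norm_gt]
  have hlim : Tendsto (fun r : ℝ => C / (ENNReal.ofReal r ^ 2)) atTop (𝓝 0) := by
    have h1 : Tendsto (fun r : ℝ => ENNReal.ofReal r ^ 2) atTop (𝓝 ∞) := by
      have := ENNReal.Tendsto.pow (n := 2) ENNReal.tendsto_ofReal_atTop
      simpa using this
    have := ENNReal.Tendsto.const_div (a := C) h1 (Or.inr hC)
    simpa using this
  refine tendsto_of_tendsto_of_tendsto_of_le_of_le' tendsto_const_nhds hlim
    (Eventually.of_forall fun _ => zero_le) ?_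
  filter_upwards [eventually_gt_atTop 0] with r hr
  refine iSup₂_le fun μ hμ => ?_
  have hr' : ENNReal.ofReal r ^ 2 ≠ 0 := by positivity
  rw [ENNReal.le_div_iff_mul_le (Or.inl hr') (Or.inl (by finiteness)), mul_comm]
  calc ENNReal.ofReal r ^ 2 * μ {x | r < ‖x‖}
      ≤ ENNReal.ofReal r ^ 2 * μ {x | ENNReal.ofReal r ^ 2 ≤ ‖x‖ₑ ^ 2} := by
        gcongr with x
        intro hx
        gcongr
        rw [← ofReal_norm]
        exact ENNReal.ofReal_le_ofReal hx.le
    _ ≤ ∫⁻ x, ‖x‖ₑ ^ 2 ∂μ := mul_meas_ge_le_lintegral (by fun_prop) _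
    _ ≤ C := h μ hμ

/-- Every sequence of probability measures with uniformly bounded second moments has a weakly
convergent subsequence. -/
theorem exists_subseq_tendsto_of_lintegral_sq_le (u : ℕ → ProbabilityMeasure X) {C : ℝ≥0∞}
    (hC : C ≠ ∞) (h : ∀ n, ∫⁻ x, ‖x‖ₑ ^ 2 ∂(u n : Measure X) ≤ C) :
    ∃ μ : ProbabilityMeasure X, ∃ φ : ℕ → ℕ, StrictMono φ ∧ Tendsto (u ∘ φ) atTop (𝓝 μ) := by
  have ht : IsTightMeasureSet {((μ : ProbabilityMeasure X) : Measure X) | μ ∈ range u} := by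
    refine isTightMeasureSet_of_lintegral_sq_le hC ?_
    rintro _ ⟨_, ⟨n, rfl⟩, rfl⟩
    exact h n
  obtain ⟨μ, -, φ, hφ, hlim⟩ :=
    (isCompact_closure_of_isTightMeasureSet ht).isSeqCompact
      (fun n => subset_closure (mem_range_self n))
  exact ⟨μ, φ, hφ, hlim⟩

end Compactness

/-- Integrals of squared norms of continuous maps are lower semicontinuous under weak
convergence. -/
theorem lintegral_sq_le_of_tendsto {X F : Type*} [TopologicalSpace X] [MeasurableSpace X]
    [OpensMeasurableSpace X] [HasOuterApproxClosed X] [NormedAddCommGroup F]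
    {u : ℕ → ProbabilityMeasure X} {μ : ProbabilityMeasure X} (hu : Tendsto u atTop (𝓝 μ))
    {f : X → F} (hf : Continuous f) {c : ℕ → ℝ≥0∞}
    {C : ℝ≥0∞} (hc : Tendsto c atTop (𝓝 C)) (h : ∀ n, ∫⁻ x, ‖f x‖ₑ ^ 2 ∂(u n : Measure X) ≤ c n) :
    ∫⁻ x, ‖f x‖ₑ ^ 2 ∂(μ : Measure X) ≤ C := by
  have key : ∀ x, ‖f x‖ₑ ^ 2 = ENNReal.ofReal (‖f x‖ ^ 2) := fun x => by
    rw [ENNReal.ofReal_pow (norm_nonneg _), ofReal_norm]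
  simp_rw [key] at h ⊢
  refine (lintegral_le_liminf_lintegral_of_forall_isOpen_measure_le_liminf_measure
    (μs := fun n => (u n : Measure X)) (by fun_prop) (fun x => by positivity)
    fun G hG => ProbabilityMeasure.le_liminf_measure_open_of_tendsto hu hG).trans ?_
  exact (liminf_le_liminf (Eventually.of_forall h)).trans_eq hc.liminf_eq

/-! ### Optimal plans and completeness of `P₂(ℝᵈ)` -/

section Couplings

variable {d : ℕ}

theorem enorm_sq_sub_le {F : Type*} [SeminormedAddCommGroup F] (x y : F) :
    ‖x - y‖ₑ ^ 2 ≤ 2 * ‖x‖ₑ ^ 2 + 2 * ‖y‖ₑ ^ 2 := by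
  have h1 : ‖x - y‖₊ ^ 2 ≤ 2 * ‖x‖₊ ^ 2 + 2 * ‖y‖₊ ^ 2 := by
    rw [← NNReal.coe_le_coe]
    push_cast
    nlinarith [norm_sub_le x y, norm_nonneg (x - y), sq_nonneg (‖x‖ - ‖y‖)]
  simp only [enorm_eq_nnnorm]
  exact_mod_cast h1

theorem isProbabilityMeasure_of_mem_couplings {μ ν : P2 d}
    {γ : Measure (EuclideanSpace ℝ (Fin d) × EuclideanSpace ℝ (Fin d))}
    (hγ : γ ∈ couplings μ ν) : IsProbabilityMeasure γ := by
  constructor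
  have h : (γ.map Prod.fst) univ = 1 := by rw [hγ.1]; exact measure_univ
  rwa [Measure.map_apply measurable_fst MeasurableSet.univ] at h

theorem exists_coupling_lintegral_lt {μ ν : P2 d} {c : ℝ≥0∞} (h : transportCost μ ν < c) :
    ∃ γ ∈ couplings μ ν, ∫⁻ p, ‖p.1 - p.2‖ₑ ^ 2 ∂γ < c := by
  simpa only [transportCost, iInf_lt_iff, exists_prop] using h

/-- Supplies the uniform moment bounds behind tightness: a measure at bounded cost from a fixed one
has bounded second moment, since `y = x - (x - y)`. -/
theorem lintegral_sq_snd_le {μ ν : P2 d}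
    {γ : Measure (EuclideanSpace ℝ (Fin d) × EuclideanSpace ℝ (Fin d))}
    (hγ : γ ∈ couplings μ ν) :
    ∫⁻ y, ‖y‖ₑ ^ 2 ∂ν.toMeasure ≤
      2 * ∫⁻ x, ‖x‖ₑ ^ 2 ∂μ.toMeasure + 2 * ∫⁻ p, ‖p.1 - p.2‖ₑ ^ 2 ∂γ := by
  rw [← hγ.1, ← hγ.2, lintegral_map (by fun_prop) measurable_fst,
    lintegral_map (by fun_prop) measurable_snd, ← lintegral_const_mul _ (by fun_prop),
    ← lintegral_const_mul _ (by fun_prop), ← lintegral_add_left (by fun_prop)]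
  refine lintegral_mono fun p => ?_
  simpa using enorm_sq_sub_le p.1 (p.1 - p.2)

/-- If probability measures converge weakly, and they can be coupled with `ν` at costs `c n → C`,
then the limit can be coupled with `ν` at cost `C`. -/
theorem exists_coupling_of_tendsto {ν μ : P2 d} {u : ℕ → P2 d}
    (hu : Tendsto (fun n => (u n).1) atTop (𝓝 μ.1)) {c : ℕ → ℝ≥0} {C : ℝ≥0}
    (hc : Tendsto c atTop (𝓝 C))
    (h : ∀ n, ∃ γ ∈ couplings ν (u n), ∫⁻ p, ‖p.1 - p.2‖ₑ ^ 2 ∂γ ≤ c n) :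
    ∃ γ ∈ couplings ν μ, ∫⁻ p, ‖p.1 - p.2‖ₑ ^ 2 ∂γ ≤ C := by
  choose γ hγ hγc using h
  obtain ⟨B, hB⟩ := hc.bddAbove_range
  let g : ℕ → ProbabilityMeasure (EuclideanSpace ℝ (Fin d) × EuclideanSpace ℝ (Fin d)) :=
    fun n => ⟨γ n, isProbabilityMeasure_of_mem_couplings (hγ n)⟩
  have hν : ∫⁻ x, ‖x‖ₑ ^ 2 ∂ν.toMeasure < ∞ := ν.2
  have hbound : ∀ n, ∫⁻ p, ‖p‖ₑ ^ 2 ∂(g n).toMeasure ≤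
      ∫⁻ x, ‖x‖ₑ ^ 2 ∂ν.toMeasure + (2 * ∫⁻ x, ‖x‖ₑ ^ 2 ∂ν.toMeasure + 2 * B) := by
    intro n
    have h1 : ∀ p : EuclideanSpace ℝ (Fin d) × EuclideanSpace ℝ (Fin d),
        ‖p‖ₑ ^ 2 ≤ ‖p.1‖ₑ ^ 2 + ‖p.2‖ₑ ^ 2 := fun p => by
      simp only [enorm_eq_nnnorm, Prod.nnnorm_def]
      rcases le_total ‖p.1‖₊ ‖p.2‖₊ with h | h
      · rw [sup_eq_right.2 h]; exact le_add_self
      · rw [sup_eq_left.2 h]; exact le_self_add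
    calc ∫⁻ p, ‖p‖ₑ ^ 2 ∂γ n ≤ ∫⁻ p, ‖p.1‖ₑ ^ 2 + ‖p.2‖ₑ ^ 2 ∂γ n := lintegral_mono h1
      _ = ∫⁻ x, ‖x‖ₑ ^ 2 ∂ν.toMeasure + ∫⁻ x, ‖x‖ₑ ^ 2 ∂(u n).toMeasure := by
        rw [lintegral_add_left (by fun_prop), ← (hγ n).1, ← (hγ n).2,
          lintegral_map (by fun_prop) measurable_fst, lintegral_map (by fun_prop) measurable_snd]
      _ ≤ _ := by
        gcongr
        refine (lintegral_sq_snd_le (hγ n)).trans ?_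
        gcongr
        refine (hγc n).trans ?_
        exact_mod_cast hB (mem_range_self n)
  obtain ⟨G, φ, hφ, hG⟩ := exists_subseq_tendsto_of_lintegral_sq_le g (by finiteness) hbound
  refine ⟨G, ⟨?_, ?_⟩, ?_⟩
  · have h1 := ProbabilityMeasure.tendsto_map_of_tendsto_of_continuous _ _ hG continuous_fst
    have h2 : ∀ n, (g (φ n)).map (continuous_fst.measurable.aemeasurable) = ν.1 := fun n =>
      Subtype.ext (hγ (φ n)).1
    simp only [Function.comp_apply, h2] at h1
    exact congrArg ProbabilityMeasure.toMeasure (tendsto_nhds_unique h1 tendsto_const_nhds)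
  · have h1 := ProbabilityMeasure.tendsto_map_of_tendsto_of_continuous _ _ hG continuous_snd
    have h2 : ∀ n, (g (φ n)).map (continuous_snd.measurable.aemeasurable) = (u (φ n)).1 :=
      fun n => Subtype.ext (hγ (φ n)).2
    simp only [Function.comp_apply, h2] at h1
    exact congrArg ProbabilityMeasure.toMeasure (tendsto_nhds_unique h1 (hu.comp hφ.tendsto_atTop))
  · exact lintegral_sq_le_of_tendsto hG (by fun_prop)
      (ENNReal.tendsto_coe.2 (hc.comp hφ.tendsto_atTop)) fun n => hγc (φ n)

/-- Optimal transport plans exist. -/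
theorem exists_optimal_coupling (μ ν : P2 d) :
    ∃ γ ∈ couplings μ ν, ∫⁻ p, ‖p.1 - p.2‖ₑ ^ 2 ∂γ = transportCost μ ν := by
  have hfin := (transportCost_lt_top μ ν).ne
  obtain ⟨γ, hγ, hle⟩ := exists_coupling_of_tendsto (ν := μ) (μ := ν) (u := fun _ => ν)
    tendsto_const_nhds (c := fun n => (transportCost μ ν).toNNReal + 1 / ((n : ℝ≥0) + 1))
    (C := (transportCost μ ν).toNNReal)
    (by simpa using tendsto_const_nhds.add (tendsto_one_div_add_atTop_nhds_zero_nat (𝕜 := ℝ≥0)))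
    (fun n => by
      obtain ⟨γ, hγ, hlt⟩ := exists_coupling_lintegral_lt (μ := μ) (ν := ν)
        (c := ((transportCost μ ν).toNNReal + 1 / ((n : ℝ≥0) + 1) : ℝ≥0)) (by
          rw [ENNReal.coe_add, ENNReal.coe_toNNReal hfin]
          exact ENNReal.lt_add_right hfin (by simp))
      exact ⟨γ, hγ, hlt.le⟩)
  rw [ENNReal.coe_toNNReal hfin] at hle
  exact ⟨γ, hγ, hle.antisymm (iInf₂_le γ hγ)⟩

theorem W2_nonneg (μ ν : P2 d) : 0 ≤ W2 μ ν := Real.sqrt_nonneg _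

theorem W2_sq (μ ν : P2 d) : W2 μ ν ^ 2 = (transportCost μ ν).toReal :=
  Real.sq_sqrt ENNReal.toReal_nonneg

theorem transportCost_eq_ofReal (μ ν : P2 d) :
    transportCost μ ν = ENNReal.ofReal (W2 μ ν ^ 2) := by
  rw [W2_sq, ENNReal.ofReal_toReal (transportCost_lt_top μ ν).ne]

theorem W2_comm (μ ν : P2 d) : W2 μ ν = W2 ν μ := by
  have key : ∀ μ ν : P2 d, transportCost μ ν ≤ transportCost ν μ := fun μ ν => by
    obtain ⟨γ, hγ, h⟩ := exists_optimal_coupling ν μ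
    rw [← h]
    have hswap : γ.map Prod.swap ∈ couplings μ ν := by
      constructor
      · rw [Measure.map_map measurable_fst measurable_swap]; exact hγ.2
      · rw [Measure.map_map measurable_snd measurable_swap]; exact hγ.1
    refine (iInf₂_le _ hswap).trans_eq ?_
    rw [lintegral_map (by fun_prop) measurable_swap]
    simp [enorm_sub_rev]
  rw [W2, W2, (key μ ν).antisymm (key ν μ)]

theorem eq_of_W2_eq_zero {μ ν : P2 d} (h : W2 μ ν = 0) : μ = ν := by
  obtain ⟨γ, hγ, hc⟩ := exists_optimal_coupling μ ν
  rw [transportCost_eq_ofReal, h] at hc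
  have hae : Prod.fst =ᵐ[γ] Prod.snd := by
    have := (lintegral_eq_zero_iff (by fun_prop)).1 (hc.trans (by simp))
    filter_upwards [this] with p hp
    simpa [sub_eq_zero] using hp
  refine Subtype.ext (Subtype.ext ?_)
  exact hγ.1.symm.trans ((Measure.map_congr hae).trans hγ.2)

/-- Completeness of `P₂(ℝᵈ)`. -/
theorem exists_W2_limit {u : ℕ → P2 d}
    (hu : ∀ ε > 0, ∃ N, ∀ m ≥ N, ∀ n ≥ N, W2 (u m) (u n) ≤ ε) :
    ∃ μ : P2 d, Tendsto (fun n => W2 (u n) μ) atTop (𝓝 0) := by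
  have hcoupl : ∀ {μ ν : P2 d} {ε : ℝ}, W2 μ ν ≤ ε →
      ∃ γ ∈ couplings μ ν, ∫⁻ p, ‖p.1 - p.2‖ₑ ^ 2 ∂γ ≤ (Real.toNNReal (ε ^ 2) : ℝ≥0) := by
    intro μ ν ε h
    obtain ⟨γ, hγ, hc⟩ := exists_optimal_coupling μ ν
    refine ⟨γ, hγ, ?_⟩
    rw [hc, transportCost_eq_ofReal]
    exact ENNReal.ofReal_le_ofReal (pow_le_pow_left₀ (W2_nonneg _ _) h 2)
  obtain ⟨N₀, hN₀⟩ := hu 1 one_pos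
  have h₀ : ∫⁻ x, ‖x‖ₑ ^ 2 ∂(u N₀).toMeasure < ∞ := (u N₀).2
  let B : ℝ≥0∞ := 2 * ∫⁻ x, ‖x‖ₑ ^ 2 ∂(u N₀).toMeasure + 2 * (Real.toNNReal (1 ^ 2) : ℝ≥0)
  have hBtop : B ≠ ∞ := by finiteness
  have hB : ∀ n, ∫⁻ x, ‖x‖ₑ ^ 2 ∂(u (N₀ + n)).toMeasure ≤ B := fun n => by
    obtain ⟨γ, hγ, hc⟩ := hcoupl (hN₀ N₀ le_rfl (N₀ + n) (by lia))
    exact (lintegral_sq_snd_le hγ).trans (add_le_add_right (mul_le_mul_right hc 2) _)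
  obtain ⟨μ, φ, hφ, hμ⟩ := exists_subseq_tendsto_of_lintegral_sq_le (fun n => (u (N₀ + n)).1)
    hBtop hB
  have hμ2 : ∫⁻ x, ‖x‖ₑ ^ 2 ∂(μ : Measure (EuclideanSpace ℝ (Fin d))) ≤ B :=
    lintegral_sq_le_of_tendsto hμ continuous_id tendsto_const_nhds fun n => hB (φ n)
  refine ⟨⟨μ, hμ2.trans_lt hBtop.lt_top⟩, ?_⟩
  rw [Metric.tendsto_atTop]
  intro ε hε
  obtain ⟨N, hN⟩ := hu (ε / 2) (by positivity)
  refine ⟨N, fun n hn => ?_⟩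
  -- Fix `n` and pass to the weak limit along the subsequence only. The shift by `N` keeps its
  -- indices past `N`, so the Cauchy bound `ε / 2` survives in the limit.
  obtain ⟨γ, hγ, hc⟩ := exists_coupling_of_tendsto (ν := u n) (μ := ⟨μ, hμ2.trans_lt hBtop.lt_top⟩)
    (u := fun k => u (N₀ + φ (N + k))) (c := fun _ => Real.toNNReal ((ε / 2) ^ 2))
    (hμ.comp (tendsto_add_atTop_nat N |>.congr fun k => by rw [add_comm])) tendsto_const_nhds
    fun k => hcoupl (hN n hn _ (by have := hφ.id_le (N + k); simp only [id] at this; lia))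
  have h1 : W2 (u n) ⟨μ, hμ2.trans_lt hBtop.lt_top⟩ ^ 2 ≤ (ε / 2) ^ 2 := by
    rw [W2_sq]
    refine ENNReal.toReal_le_of_le_ofReal (by positivity) ((iInf₂_le γ hγ).trans hc)
  have h2 := abs_le_of_sq_le_sq h1 (by positivity)
  rw [Real.dist_eq, sub_zero]
  exact h2.trans_lt (by linarith)

end Couplings

/-! ### Couplings as random variables, and gluing -/

section RandomVariables

variable {d : ℕ} {Ω : Type*} [MeasurableSpace Ω] {P : Measure Ω}

theorem memLp_two_of_map_eq {X : Ω → EuclideanSpace ℝ (Fin d)} (hX : Measurable X) {μ : P2 d}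
    (h : P.map X = μ.toMeasure) : MemLp X 2 P := by
  refine ⟨hX.aestronglyMeasurable, ?_⟩
  rw [eLpNorm_lt_top_iff_lintegral_rpow_enorm_lt_top (by simp) (by simp)]
  have hμ : ∫⁻ x, ‖x‖ₑ ^ 2 ∂μ.toMeasure < ∞ := μ.2
  rw [← h, lintegral_map (by fun_prop) hX] at hμ
  simpa using hμ

theorem exists_toMeasure_eq_map [IsProbabilityMeasure P] {X : Ω → EuclideanSpace ℝ (Fin d)}
    (hX : Measurable X) (h : MemLp X 2 P) : ∃ μ : P2 d, P.map X = μ.toMeasure := by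
  have : IsProbabilityMeasure (P.map X) := Measure.isProbabilityMeasure_map hX.aemeasurable
  refine ⟨⟨⟨P.map X, this⟩, ?_⟩, rfl⟩
  change ∫⁻ x, ‖x‖ₑ ^ 2 ∂(P.map X) < ∞
  rw [lintegral_map (by fun_prop) hX]
  have := (eLpNorm_lt_top_iff_lintegral_rpow_enorm_lt_top (by simp) (by simp)).1 h.2
  simpa using this

theorem integrable_norm_sub_sq {X Y : Ω → EuclideanSpace ℝ (Fin d)} (hX : MemLp X 2 P)
    (hY : MemLp Y 2 P) : Integrable (fun ω => ‖X ω - Y ω‖ ^ 2) P := by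
  simpa using (hX.sub hY).integrable_norm_pow (by simp)

theorem W2_sq_le_integral {X Y : Ω → EuclideanSpace ℝ (Fin d)} (hX : Measurable X)
    (hY : Measurable Y) {μ ν : P2 d} (hXμ : P.map X = μ.toMeasure) (hYν : P.map Y = ν.toMeasure) :
    W2 μ ν ^ 2 ≤ ∫ ω, ‖X ω - Y ω‖ ^ 2 ∂P := by
  have hmem : P.map (fun ω => (X ω, Y ω)) ∈ couplings μ ν := by
    constructor
    · rw [Measure.map_map measurable_fst (hX.prodMk hY)]; exact hXμ
    · rw [Measure.map_map measurable_snd (hX.prodMk hY)]; exact hYν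
  have hint := integrable_norm_sub_sq (memLp_two_of_map_eq hX hXμ) (memLp_two_of_map_eq hY hYν)
  rw [W2_sq]
  refine ENNReal.toReal_le_of_le_ofReal (integral_nonneg fun _ => by positivity) ?_
  rw [ofReal_integral_eq_lintegral_ofReal hint (Eventually.of_forall fun _ => by positivity)]
  refine (iInf₂_le _ hmem).trans_eq ?_
  rw [lintegral_map (by fun_prop) (hX.prodMk hY)]
  simp_rw [ENNReal.ofReal_pow (norm_nonneg _), ofReal_norm]

/-- Gluing: a random variable `Z` with law `μ` can be optimally coupled with `ν` on an extension
of its probability space. -/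
theorem exists_optimal_extension [IsProbabilityMeasure P] {Z : Ω → EuclideanSpace ℝ (Fin d)}
    (hZ : Measurable Z) {μ : P2 d} (h : P.map Z = μ.toMeasure) (ν : P2 d) :
    ∃ Q : Measure (Ω × EuclideanSpace ℝ (Fin d)), IsProbabilityMeasure Q ∧
      Q.map Prod.fst = P ∧ Q.map Prod.snd = ν.toMeasure ∧
      ∫ p, ‖Z p.1 - p.2‖ ^ 2 ∂Q = W2 μ ν ^ 2 := by
  obtain ⟨γ, hγ, hc⟩ := exists_optimal_coupling μ ν
  have := isProbabilityMeasure_of_mem_couplings hγ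
  -- Given `ω`, draw the new coordinate from the conditional law under `γ` of the second variable
  -- given that the first equals `Z ω`.
  let Q := P ⊗ₘ (γ.condKernel.comap Z hZ)
  have hm : Measurable fun p : Ω × EuclideanSpace ℝ (Fin d) => (Z p.1, p.2) := by fun_prop
  have hQγ : Q.map (fun p => (Z p.1, p.2)) = γ := by
    refine Eq.trans ?_ (γ.disintegrate γ.condKernel)
    ext s hs
    have hγ1 : γ.fst = P.map Z := hγ.1.trans h.symm
    have hs' := Kernel.measurable_kernel_prodMk_left (κ := γ.condKernel) hs
    rw [Measure.map_apply hm hs, Measure.compProd_apply (hm hs), Measure.compProd_apply hs, hγ1,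
      lintegral_map hs' hZ]
    rfl
  refine ⟨Q, inferInstance, Measure.fst_compProd _ _, ?_, ?_⟩
  · rw [← hγ.2, ← hQγ, Measure.map_map measurable_snd hm]
    rfl
  · have h1 : ∫ p, ‖Z p.1 - p.2‖ ^ 2 ∂Q = ∫ p, ‖p.1 - p.2‖ ^ 2 ∂γ := by
      rw [← hQγ, integral_map hm.aemeasurable (by fun_prop)]
    rw [h1, W2_sq, ← hc, integral_eq_lintegral_of_nonneg_ae
      (Eventually.of_forall fun _ => by positivity) (by fun_prop)]
    simp_rw [ENNReal.ofReal_pow (norm_nonneg _), ofReal_norm]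

/-- The defect term does not involve `z`, so it is the same for `μ₀` and `μ₁` and can cancel between
the two transport costs. -/
theorem norm_interp_sub_sq {F : Type*} [NormedAddCommGroup F] [InnerProductSpace ℝ F] (t : ℝ)
    (x y z : F) : ‖((1 - t) • x + t • y) - z‖ ^ 2 =
      (1 - t) * ‖x - z‖ ^ 2 + t * ‖y - z‖ ^ 2 - t * (1 - t) * ‖x - y‖ ^ 2 := by
  have h1 : ((1 - t) • x + t • y) - z = (1 - t) • (x - z) + t • (y - z) := by module
  have h2 : x - y = (x - z) - (y - z) := by abel
  rw [h1, h2]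
  generalize x - z = a
  generalize y - z = b
  rw [norm_add_sq_real, norm_sub_sq_real, norm_smul, norm_smul, mul_pow, mul_pow,
    inner_smul_left, inner_smul_right, Real.norm_eq_abs, Real.norm_eq_abs, sq_abs, sq_abs]
  simp only [conj_trivial]
  ring

theorem integral_norm_interp_sub_sq {X Y Z : Ω → EuclideanSpace ℝ (Fin d)} (hX : MemLp X 2 P)
    (hY : MemLp Y 2 P) (hZ : MemLp Z 2 P) (t : ℝ) :
    ∫ ω, ‖((1 - t) • X ω + t • Y ω) - Z ω‖ ^ 2 ∂P =
      (1 - t) * ∫ ω, ‖X ω - Z ω‖ ^ 2 ∂P + t * ∫ ω, ‖Y ω - Z ω‖ ^ 2 ∂P -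
        t * (1 - t) * ∫ ω, ‖X ω - Y ω‖ ^ 2 ∂P := by
  have h1 := (integrable_norm_sub_sq hX hZ).const_mul (1 - t)
  have h2 := (integrable_norm_sub_sq hY hZ).const_mul t
  have h3 := (integrable_norm_sub_sq hX hY).const_mul (t * (1 - t))
  simp_rw [norm_interp_sub_sq]
  rw [integral_sub (by exact h1.add h2) h3, integral_add h1 h2]
  simp_rw [integral_const_mul]

/-- Young's inequality with free weight `s`; optimizing `s` after integration replaces Minkowski's
inequality in `W2_triangle`. -/
theorem norm_sub_sq_le_of_pos {F : Type*} [NormedAddCommGroup F] {s : ℝ} (hs : 0 < s)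
    (x y z : F) : ‖x - z‖ ^ 2 ≤ (1 + s) * ‖x - y‖ ^ 2 + (1 + s⁻¹) * ‖y - z‖ ^ 2 := by
  have h1 := norm_sub_le_norm_sub_add_norm_sub x y z
  have h2 : ‖x - z‖ ^ 2 ≤ (‖x - y‖ + ‖y - z‖) ^ 2 := pow_le_pow_left₀ (norm_nonneg _) h1 2
  have h3 : 0 ≤ s⁻¹ * (s * ‖x - y‖ - ‖y - z‖) ^ 2 := by positivity
  have h4 : s⁻¹ * (s * ‖x - y‖ - ‖y - z‖) ^ 2 =
      s * ‖x - y‖ ^ 2 - 2 * ‖x - y‖ * ‖y - z‖ + s⁻¹ * ‖y - z‖ ^ 2 := by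
    field_simp
    ring
  linarith

end RandomVariables

/-! ### Triangle inequality and convexity along generalized geodesics -/

section Geometry

variable {d : ℕ}

/-- Glue along the middle measure: both outer variables are optimally coupled to a variable of law
`ν`. -/
theorem W2_triangle (μ ν ρ : P2 d) : W2 μ ρ ≤ W2 μ ν + W2 ν ρ := by
  obtain ⟨Q₁, _, hQ₁, hQ₁', hc₁⟩ := exists_optimal_extension (P := ν.toMeasure) measurable_id
    (μ := ν) Measure.map_id μ
  obtain ⟨Q₂, _, hQ₂, hQ₂', hc₂⟩ := exists_optimal_extension (P := Q₁) measurable_fst hQ₁ ρ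
  have hY : Q₂.map (fun p => p.1.1) = ν.toMeasure := by
    rw [← hQ₁, ← hQ₂, Measure.map_map measurable_fst measurable_fst]; rfl
  have hX : Q₂.map (fun p => p.1.2) = μ.toMeasure := by
    rw [← hQ₁', ← hQ₂, Measure.map_map measurable_snd measurable_fst]; rfl
  have hXY : ∫ p, ‖p.1.2 - p.1.1‖ ^ 2 ∂Q₂ = W2 μ ν ^ 2 := by
    rw [W2_comm, ← hc₁, ← hQ₂, integral_map (by fun_prop) (by fun_prop)]
    simp_rw [id, norm_sub_rev]
  have key : ∀ s > 0, W2 μ ρ ^ 2 ≤ (1 + s) * W2 μ ν ^ 2 + (1 + s⁻¹) * W2 ν ρ ^ 2 := by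
    intro s hs
    have mX := memLp_two_of_map_eq (by fun_prop) hX
    have mY := memLp_two_of_map_eq (by fun_prop) hY
    have mZ := memLp_two_of_map_eq (by fun_prop) hQ₂'
    have i1 := (integrable_norm_sub_sq mX mY).const_mul (1 + s)
    have i2 := (integrable_norm_sub_sq mY mZ).const_mul (1 + s⁻¹)
    refine (W2_sq_le_integral (by fun_prop) (by fun_prop) hX hQ₂').trans ?_
    rw [← hXY, ← hc₂, ← integral_const_mul, ← integral_const_mul, ← integral_add i1 i2]
    exact integral_mono (integrable_norm_sub_sq mX mZ) (i1.add i2) fun p =>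
      norm_sub_sq_le_of_pos hs p.1.2 p.1.1 p.2
  refine le_of_forall_pos_le_add fun ε hε => ?_
  have ha := W2_nonneg μ ν
  have hb := W2_nonneg ν ρ
  set a := W2 μ ν
  set b := W2 ν ρ
  have hle : W2 μ ρ ^ 2 ≤ (a + b + ε) ^ 2 := by
    -- The optimal weight is `b / a`; adding `ε / 2` to each keeps it positive and finite when `a`
    -- or `b` vanishes.
    have h1 := key ((b + ε / 2) / (a + ε / 2)) (by positivity)
    calc W2 μ ρ ^ 2 ≤ _ := h1
      _ ≤ (1 + (b + ε / 2) / (a + ε / 2)) * (a + ε / 2) ^ 2 +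
          (1 + ((b + ε / 2) / (a + ε / 2))⁻¹) * (b + ε / 2) ^ 2 := by
        gcongr <;> linarith
      _ = (a + b + ε) ^ 2 := by
        field_simp
        ring
  exact (pow_le_pow_iff_left₀ (W2_nonneg _ _) (by positivity) two_ne_zero).1 hle

/-- The extrapolation functional is strongly convex along the interpolations of `ρ₀` and `ρ₁` by
generalized geodesics based at `μ₁`. -/
theorem exists_extrapolationFunctional_le {α : ℝ} (hα : 1 ≤ α) (μ₀ μ₁ ρ₀ ρ₁ : P2 d) {t : ℝ}
    (ht₀ : 0 ≤ t) (ht₁ : t ≤ 1) :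
    ∃ ρ : P2 d, extrapolationFunctional α μ₀ μ₁ ρ ≤
      (1 - t) * extrapolationFunctional α μ₀ μ₁ ρ₀ + t * extrapolationFunctional α μ₀ μ₁ ρ₁ -
        t * (1 - t) * W2 ρ₀ ρ₁ ^ 2 := by
  -- In `Q₂`, `p.1.1` has law `μ₁`, and `p.1.2` and `p.2`, of laws `ρ₀` and `ρ₁`, are each optimally
  -- coupled to it. Their mutual coupling need not be optimal.
  obtain ⟨Q₁, _, hQ₁, hQ₁', hc₁⟩ := exists_optimal_extension (P := μ₁.toMeasure) measurable_id
    (μ := μ₁) Measure.map_id ρ₀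
  obtain ⟨Q₂, _, hQ₂, hY, hc₂⟩ := exists_optimal_extension (P := Q₁) measurable_fst hQ₁ ρ₁
  have hO : Q₂.map (fun p => p.1.1) = μ₁.toMeasure := by
    rw [← hQ₁, ← hQ₂, Measure.map_map measurable_fst measurable_fst]; rfl
  have hX : Q₂.map (fun p => p.1.2) = ρ₀.toMeasure := by
    rw [← hQ₁', ← hQ₂, Measure.map_map measurable_snd measurable_fst]; rfl
  have hXO : ∫ p, ‖p.1.2 - p.1.1‖ ^ 2 ∂Q₂ = W2 ρ₀ μ₁ ^ 2 := by
    rw [W2_comm, ← hc₁, ← hQ₂, integral_map (by fun_prop) (by fun_prop)]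
    simp_rw [id, norm_sub_rev]
  have hYO : ∫ p, ‖p.2 - p.1.1‖ ^ 2 ∂Q₂ = W2 ρ₁ μ₁ ^ 2 := by
    rw [W2_comm, ← hc₂]
    simp_rw [norm_sub_rev]
  have mO := memLp_two_of_map_eq (by fun_prop) hO
  have mX := memLp_two_of_map_eq (by fun_prop) hX
  have mY := memLp_two_of_map_eq (by fun_prop) hY
  have hT : Measurable fun p : (EuclideanSpace ℝ (Fin d) × EuclideanSpace ℝ (Fin d)) ×
      EuclideanSpace ℝ (Fin d) => (1 - t) • p.1.2 + t • p.2 := by fun_prop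
  obtain ⟨ρ, hρ⟩ := exists_toMeasure_eq_map hT ((mX.const_smul (1 - t)).add (mY.const_smul t))
  have hupper : W2 ρ μ₁ ^ 2 ≤ (1 - t) * W2 ρ₀ μ₁ ^ 2 + t * W2 ρ₁ μ₁ ^ 2 -
      t * (1 - t) * ∫ p, ‖p.1.2 - p.2‖ ^ 2 ∂Q₂ := by
    rw [← hXO, ← hYO, ← integral_norm_interp_sub_sq mX mY mO]
    exact W2_sq_le_integral hT (by fun_prop) hρ hO
  -- For the opposite bound, optimality is needed between the interpolant and `μ₀`; the induced
  -- couplings of `μ₀` with `ρ₀` and `ρ₁` may then be arbitrary.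
  obtain ⟨Q₃, _, hQ₃, hW, hc₃⟩ := exists_optimal_extension hT hρ μ₀
  have hX' : Q₃.map (fun p => p.1.1.2) = ρ₀.toMeasure := by
    rw [← hX, ← hQ₃, Measure.map_map (by fun_prop) measurable_fst]; rfl
  have hY' : Q₃.map (fun p => p.1.2) = ρ₁.toMeasure := by
    rw [← hY, ← hQ₃, Measure.map_map (by fun_prop) measurable_fst]; rfl
  have hlower : (1 - t) * W2 ρ₀ μ₀ ^ 2 + t * W2 ρ₁ μ₀ ^ 2 -
      t * (1 - t) * ∫ p, ‖p.1.2 - p.2‖ ^ 2 ∂Q₂ ≤ W2 ρ μ₀ ^ 2 := by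
    have hD : ∫ p, ‖p.1.2 - p.2‖ ^ 2 ∂Q₂ = ∫ p, ‖p.1.1.2 - p.1.2‖ ^ 2 ∂Q₃ := by
      rw [← hQ₃, integral_map (by fun_prop) (by fun_prop)]
    rw [← hc₃, hD, integral_norm_interp_sub_sq (memLp_two_of_map_eq (by fun_prop) hX')
      (memLp_two_of_map_eq (by fun_prop) hY') (memLp_two_of_map_eq (by fun_prop) hW)]
    have h0 := W2_sq_le_integral (by fun_prop) (by fun_prop) hX' hW
    have h1 := W2_sq_le_integral (by fun_prop) (by fun_prop) hY' hW
    have h0' := mul_le_mul_of_nonneg_left h0 (sub_nonneg.2 ht₁)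
    have h1' := mul_le_mul_of_nonneg_left h1 ht₀
    linarith
  have hD : W2 ρ₀ ρ₁ ^ 2 ≤ ∫ p, ‖p.1.2 - p.2‖ ^ 2 ∂Q₂ :=
    W2_sq_le_integral (by fun_prop) (by fun_prop) hX hY
  refine ⟨ρ, ?_⟩
  -- The defect is counted `α - (α - 1) = 1` times.
  have e1 := mul_le_mul_of_nonneg_left hupper (zero_le_one.trans hα)
  have e2 := mul_le_mul_of_nonneg_left hlower (sub_nonneg.2 hα)
  have e3 := mul_le_mul_of_nonneg_left hD (mul_nonneg ht₀ (sub_nonneg.2 ht₁))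
  simp only [extrapolationFunctional]
  linarith

end Geometry

/-! ### Existence, uniqueness and dissipativity -/

section Extrapolation

variable {d : ℕ} {α : ℝ}

/-- Minimality against the interpolant at time `t` between `ρ` and `μ`, divided by `t`, leaves the
factor `1 - t`, which tends to `1`. -/
theorem W2_sq_add_le_of_isMetricExtrapolation (hα : 1 ≤ α) {μ₀ μ₁ ρ : P2 d}
    (h : IsMetricExtrapolation α μ₀ μ₁ ρ) (μ : P2 d) :
    W2 μ ρ ^ 2 + extrapolationFunctional α μ₀ μ₁ ρ ≤ extrapolationFunctional α μ₀ μ₁ μ := by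
  rw [W2_comm]
  set A := extrapolationFunctional α μ₀ μ₁ μ
  set B := extrapolationFunctional α μ₀ μ₁ ρ
  have key : ∀ t ∈ Ioo (0 : ℝ) 1, (1 - t) * W2 ρ μ ^ 2 + B ≤ A := by
    rintro t ⟨ht₀, ht₁⟩
    obtain ⟨σ, hσ⟩ := exists_extrapolationFunctional_le hα μ₀ μ₁ ρ μ ht₀.le ht₁.le
    have h1 : B ≤ extrapolationFunctional α μ₀ μ₁ σ := h (mem_univ σ)
    have h2 : t * ((1 - t) * W2 ρ μ ^ 2 + B) ≤ t * A := by linarith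
    exact le_of_mul_le_mul_left h2 ht₀
  have hlim : Tendsto (fun t : ℝ => (1 - t) * W2 ρ μ ^ 2 + B) (𝓝[>] 0)
      (𝓝 (W2 ρ μ ^ 2 + B)) := by
    have : Continuous fun t : ℝ => (1 - t) * W2 ρ μ ^ 2 + B := by fun_prop
    simpa using (this.tendsto 0).mono_left nhdsWithin_le_nhds
  exact le_of_tendsto hlim (by
    filter_upwards [Ioo_mem_nhdsGT one_pos] with t ht using key t ht)

theorem eq_of_isMetricExtrapolation (hα : 1 ≤ α) {μ₀ μ₁ ρ ρ' : P2 d}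
    (h : IsMetricExtrapolation α μ₀ μ₁ ρ) (h' : IsMetricExtrapolation α μ₀ μ₁ ρ') : ρ' = ρ := by
  have h1 := W2_sq_add_le_of_isMetricExtrapolation hα h ρ'
  have h2 : extrapolationFunctional α μ₀ μ₁ ρ' ≤ extrapolationFunctional α μ₀ μ₁ ρ :=
    h' (mem_univ ρ)
  refine eq_of_W2_eq_zero (pow_eq_zero_iff two_ne_zero |>.1 (le_antisymm ?_ (sq_nonneg _)))
  linarith

theorem bddBelow_range_extrapolationFunctional (hα : 1 ≤ α) (μ₀ μ₁ : P2 d) :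
    BddBelow (range (extrapolationFunctional α μ₀ μ₁)) := by
  -- With `x = W2 ρ μ₁` and `c = W2 μ₁ μ₀`, completing the square gives `αx² - (α - 1)(x + c)² = (x
  -- - (α - 1)c)² - α(α - 1)c²`.
  refine ⟨-(α * (α - 1) * W2 μ₁ μ₀ ^ 2), ?_⟩
  rintro _ ⟨ρ, rfl⟩
  have h1 : W2 ρ μ₀ ^ 2 ≤ (W2 ρ μ₁ + W2 μ₁ μ₀) ^ 2 :=
    pow_le_pow_left₀ (W2_nonneg _ _) (W2_triangle _ _ _) 2
  have h2 := mul_le_mul_of_nonneg_left h1 (sub_nonneg.2 hα)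
  simp only [extrapolationFunctional]
  nlinarith [sq_nonneg (W2 ρ μ₁ - (α - 1) * W2 μ₁ μ₀)]

theorem tendsto_W2_of_tendsto_zero {u : ℕ → P2 d} {μ : P2 d}
    (h : Tendsto (fun n => W2 (u n) μ) atTop (𝓝 0)) (ν : P2 d) :
    Tendsto (fun n => W2 (u n) ν) atTop (𝓝 (W2 μ ν)) := by
  rw [tendsto_iff_dist_tendsto_zero]
  refine squeeze_zero (fun _ => dist_nonneg) (fun n => ?_) h
  rw [Real.dist_eq, abs_sub_le_iff]
  have h1 := W2_triangle (u n) μ ν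
  have h2 := W2_triangle μ (u n) ν
  rw [W2_comm μ (u n)] at h2
  constructor <;> linarith

theorem exists_isMetricExtrapolation (hα : 1 ≤ α) (μ₀ μ₁ : P2 d) :
    ∃ ρ, IsMetricExtrapolation α μ₀ μ₁ ρ := by
  have hbdd := bddBelow_range_extrapolationFunctional hα μ₀ μ₁
  set m := sInf (range (extrapolationFunctional α μ₀ μ₁))
  have hm : ∀ ρ, m ≤ extrapolationFunctional α μ₀ μ₁ ρ := fun ρ => csInf_le hbdd ⟨ρ, rfl⟩
  have hmin : ∀ n : ℕ, ∃ ρ, extrapolationFunctional α μ₀ μ₁ ρ < m + 1 / ((n : ℝ) + 1) := fun n => by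
    obtain ⟨_, ⟨ρ, rfl⟩, hρ⟩ := Real.lt_sInf_add_pos
      (s := range (extrapolationFunctional α μ₀ μ₁)) ⟨_, μ₀, rfl⟩
      (Nat.one_div_pos_of_nat (α := ℝ) (n := n))
    exact ⟨ρ, hρ⟩
  choose u hu using hmin
  -- The midpoint interpolant has value at least `m`, so a quarter of the squared distance is at
  -- most the mean excess of `u i` and `u j` over `m`.
  have hdist : ∀ i j : ℕ, W2 (u i) (u j) ^ 2 ≤ 2 * (1 / ((i : ℝ) + 1) + 1 / ((j : ℝ) + 1)) := by
    intro i j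
    obtain ⟨σ, hσ⟩ := exists_extrapolationFunctional_le hα μ₀ μ₁ (u i) (u j) (t := 1 / 2)
      (by norm_num) (by norm_num)
    linarith [hm σ, hu i, hu j]
  obtain ⟨ρ, hρ⟩ := exists_W2_limit (u := u) fun ε hε => by
    obtain ⟨N, hN⟩ := exists_nat_one_div_lt (show 0 < ε ^ 2 / 4 by positivity)
    refine ⟨N, fun i hi j hj => ?_⟩
    have h1 := Nat.one_div_le_one_div (α := ℝ) hi
    have h2 := Nat.one_div_le_one_div (α := ℝ) hj
    refine (pow_le_pow_iff_left₀ (W2_nonneg _ _) hε.le two_ne_zero).1 ?_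
    linarith [hdist i j]
  refine ⟨ρ, fun μ _ => ?_⟩
  have hF : Tendsto (fun n => extrapolationFunctional α μ₀ μ₁ (u n)) atTop
      (𝓝 (extrapolationFunctional α μ₀ μ₁ ρ)) :=
    (((tendsto_W2_of_tendsto_zero hρ μ₁).pow 2).const_mul α).sub
      (((tendsto_W2_of_tendsto_zero hρ μ₀).pow 2).const_mul (α - 1))
  have hlim : Tendsto (fun n : ℕ => m + 1 / ((n : ℝ) + 1)) atTop (𝓝 m) := by
    simpa using tendsto_const_nhds.add (tendsto_one_div_add_atTop_nhds_zero_nat (𝕜 := ℝ))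
  exact (le_of_tendsto_of_tendsto' hF hlim fun n => (hu n).le).trans (hm μ)

/-- Test the variational inequality at `μ₁`. With `x = W2 μ₁ ρ` and `c = W2 μ₀ μ₁`, the triangle
inequality reduces it to `x² ≤ (α - 1)cx`. -/
theorem W2_le_of_isMetricExtrapolation (hα : 1 ≤ α) {μ₀ μ₁ ρ : P2 d}
    (h : IsMetricExtrapolation α μ₀ μ₁ ρ) : W2 μ₁ ρ ≤ (α - 1) * W2 μ₀ μ₁ := by
  have h1 := W2_sq_add_le_of_isMetricExtrapolation hα h μ₁
  have h2 : W2 ρ μ₀ ^ 2 ≤ (W2 μ₁ ρ + W2 μ₀ μ₁) ^ 2 := by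
    refine pow_le_pow_left₀ (W2_nonneg _ _) ?_ 2
    rw [W2_comm μ₁ ρ, W2_comm μ₀ μ₁]
    exact W2_triangle _ _ _
  have h3 : W2 μ₁ μ₁ ^ 2 ≤ 0 := by
    simpa using W2_sq_le_integral (P := μ₁.toMeasure) measurable_id measurable_id
      (μ := μ₁) (ν := μ₁) Measure.map_id Measure.map_id
  have h4 := mul_le_mul_of_nonneg_left h2 (sub_nonneg.2 hα)
  have h5 := mul_le_mul_of_nonneg_left h3 (zero_le_one.trans hα)
  simp only [extrapolationFunctional] at h1
  rw [W2_comm ρ μ₁, W2_comm μ₁ μ₀] at h1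
  have ha := W2_nonneg μ₁ ρ
  have hb := mul_nonneg (sub_nonneg.2 hα) (W2_nonneg μ₀ μ₁)
  by_contra! hlt
  nlinarith

end Extrapolation

end WassersteinExtrapolation

theorem mainTheorem3 (d : ℕ) (α : ℝ) (hα : 1 < α) :
    (∀ μ₀ μ₁ : WassersteinExtrapolation.P2 d,
      ∃! μα : WassersteinExtrapolation.P2 d,
        WassersteinExtrapolation.IsMetricExtrapolation α μ₀ μ₁ μα) ∧
    ∀ E : WassersteinExtrapolation.P2 d → WassersteinExtrapolation.P2 d →
        WassersteinExtrapolation.P2 d,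
      (∀ μ₀ μ₁ : WassersteinExtrapolation.P2 d,
        WassersteinExtrapolation.IsMetricExtrapolation α μ₀ μ₁ (E μ₀ μ₁)) →
      WassersteinExtrapolation.IsDissipative (α - 1) E ∧
      ∀ μ₀ μ₁ μ : WassersteinExtrapolation.P2 d,
        WassersteinExtrapolation.W2 μ (E μ₀ μ₁) ^ 2 +
            WassersteinExtrapolation.extrapolationFunctional α μ₀ μ₁ (E μ₀ μ₁) ≤
          WassersteinExtrapolation.extrapolationFunctional α μ₀ μ₁ μ := by
  refine ⟨fun μ₀ μ₁ => ?_, fun E hE => ⟨⟨sub_nonneg.2 hα.le, fun μ₀ μ₁ => ?_⟩, fun μ₀ μ₁ μ => ?_⟩⟩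
  · obtain ⟨ρ, hρ⟩ := WassersteinExtrapolation.exists_isMetricExtrapolation hα.le μ₀ μ₁
    exact ⟨ρ, hρ, fun ρ' hρ' =>
      WassersteinExtrapolation.eq_of_isMetricExtrapolation hα.le hρ hρ'⟩
  · exact WassersteinExtrapolation.W2_le_of_isMetricExtrapolation hα.le (hE μ₀ μ₁)
  · exact WassersteinExtrapolation.W2_sq_add_le_of_isMetricExtrapolation hα.le (hE μ₀ μ₁) μ
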